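/- An inversion sequence of length $n$ is an integer sequence $e=e_1e_2\cdots e_n$ with $0\le e_i<i$ for all $1\le i\le n$. It is $\underline{12}0$-avoiding if there are no indices $2\le i<j\le n$ with $e_j<e_{i-1}<e_i$. Let the refined powered Catalan numbers $c_{n,k}$ be defined by $c_{1,1}=1$, $c_{n,0}=0$ for $n\ge 1$, and $$c_{n,k}=c_{n-1,k-1}+k\sum_{j=k}^{n-1}c_{n-1,j}\qquad\text{for } n\ge 2 \text{ and } 1\le k\le n.$$ Then, for all $n\ge 1$ and $1\le k\le n$, the number of $\underline{12}0$-avoiding inversion sequences of length $n$ with exactly $k$ entries equal to $0$ is $c_{n,k}$. -/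

import Mathlib

/-- An inversion sequence of length `n`: with the 1-based entries `e_1, …, e_n` written as
`e 0, …, e (n - 1)`, the condition `0 ≤ e_i < i` becomes `e i < i + 1`. -/
def IsInversionSeq {n : ℕ} (e : Fin n → ℕ) : Prop :=
  ∀ i : Fin n, e i < (i : ℕ) + 1

/-- An occurrence of the vincular pattern `120` (with the letters `12` underlined) in the word `e`:
adjacent positions `a`, `b = a + 1` and a later position `c` with `e c < e a < e b`. -/
def Contains120 {n : ℕ} (e : Fin n → ℕ) : Prop :=
  ∃ a b c : Fin n, (b : ℕ) = (a : ℕ) + 1 ∧ b < c ∧ e c < e a ∧ e a < e b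

/-- The number of zero entries of `e`. -/
def zeroCount {n : ℕ} (e : Fin n → ℕ) : ℕ :=
  (Finset.univ.filter fun i => e i = 0).card

/-- The inversion sequences of length `n` that avoid the vincular pattern `120`
(with `12` underlined) and have exactly `k` zero entries. -/
def avoidingInvSeq (n k : ℕ) : Set (Fin n → ℕ) :=
  {e | IsInversionSeq e ∧ ¬ Contains120 e ∧ zeroCount e = k}

/-- The refined powered Catalan numbers `c_{n,k}`. The values that the recurrence does not mention
(`n = 0` or `k > n`) are zero. -/
def refinedPoweredCatalan : ℕ → ℕ → ℕ
  | 0, _ => 0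
  | 1, k => if k = 1 then 1 else 0
  | _ + 2, 0 => 0
  | n + 2, k + 1 =>
      refinedPoweredCatalan (n + 1) k +
        (k + 1) * ∑ j ∈ Finset.Icc (k + 1) (n + 1), refinedPoweredCatalan (n + 1) j

theorem refinedPoweredCatalan_one_one : refinedPoweredCatalan 1 1 = 1 := rfl

theorem refinedPoweredCatalan_zero_right (n : ℕ) : refinedPoweredCatalan n 0 = 0 := by
  rcases n with _ | _ | n <;> simp [refinedPoweredCatalan]

theorem refinedPoweredCatalan_rec (n k : ℕ) (hn : 2 ≤ n) (hk : 1 ≤ k) :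
    refinedPoweredCatalan n k = refinedPoweredCatalan (n - 1) (k - 1) +
      k * ∑ j ∈ Finset.Icc k (n - 1), refinedPoweredCatalan (n - 1) j := by
  obtain ⟨n, rfl⟩ := Nat.exists_eq_add_of_le' hn
  obtain ⟨k, rfl⟩ := Nat.exists_eq_add_of_le' hk
  simp [refinedPoweredCatalan]

/-- There are finitely many inversion sequences, so that cardinalities of sets of them are
genuine. -/
theorem finite_avoidingInvSeq (n k : ℕ) : (avoidingInvSeq n k).Finite := by
  refine (Set.Finite.pi' (fun i : Fin n => Set.finite_Iio ((i : ℕ) + 1))).subset ?_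
  intro e he i
  exact he.1 i

/-! Write N(v,p,r,K) for `numShiftedAvoiders v p r K`. A leading zero can be deleted freely; a
leading a > 0 with a zero somewhere after it forces the next letter to be at most a. These two
deletions yield, by induction on k, the key identity `numShiftedAvoiders_eq`: N(p+1,p+1,r,=k) =
N(p,p,r,≥k) + k·N(p+1,p+1,r-1,≥k). At p = 0, restoring leading zeros turns it into the recurrence
for c_{n,k}. -/

/-- The words `e` of length `r` avoiding the vincular pattern `120` (with `12` underlined), whose
entry at (0-based) position `i` is at most `p + i`, whose first entry is at most `v`, and whose
number of zeros satisfies `K`. For `v = p` these are the avoiding inversion sequences of length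
`p + r` starting with `p` zeros, with those zeros deleted. -/
def shiftedAvoiders (v p r : ℕ) (K : ℕ → Prop) : Set (Fin r → ℕ) :=
  {e | (∀ i, e i ≤ p + i) ∧ ¬ Contains120 e ∧ (∀ i : Fin r, (i : ℕ) = 0 → e i ≤ v) ∧
    K (zeroCount e)}

theorem finite_shiftedAvoiders (v p r : ℕ) (K : ℕ → Prop) : (shiftedAvoiders v p r K).Finite := by
  refine (Set.Finite.pi' (fun i : Fin r => Set.finite_Iic (p + (i : ℕ)))).subset ?_
  intro e he i
  exact he.1 i

theorem contains120_cons {r : ℕ} (a : ℕ) (e : Fin r → ℕ) :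
    Contains120 (Fin.cons a e : Fin (r + 1) → ℕ) ↔
      Contains120 e ∨ ∃ b c : Fin r, (b : ℕ) = 0 ∧ e c < a ∧ a < e b := by
  constructor
  · rintro ⟨x, y, z, hxy, hyz, h1, h2⟩
    obtain ⟨y, rfl⟩ : ∃ y', y = Fin.succ y' := Fin.exists_succ_eq.2 (by
      rintro rfl; simp at hxy) |>.imp fun _ h => h.symm
    obtain ⟨z, rfl⟩ : ∃ z', z = Fin.succ z' := Fin.exists_succ_eq.2 (by
      rintro rfl; simp at hyz) |>.imp fun _ h => h.symm
    cases x using Fin.cases with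
    | zero =>
      right
      refine ⟨y, z, ?_, by simpa using h1, by simpa using h2⟩
      simpa using hxy
    | succ x =>
      left
      refine ⟨x, y, z, ?_, by simpa using hyz, by simpa using h1, by simpa using h2⟩
      simpa using hxy
  · rintro (⟨x, y, z, hxy, hyz, h1, h2⟩ | ⟨b, c, hb, h1, h2⟩)
    · exact ⟨x.succ, y.succ, z.succ, by simpa using hxy, by simpa using hyz, by simpa using h1,
        by simpa using h2⟩
    · refine ⟨0, b.succ, c.succ, by simpa using hb, ?_, by simpa using h1, by simpa using h2⟩
      rw [Fin.succ_lt_succ_iff, Fin.lt_def, hb, Nat.pos_iff_ne_zero]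
      intro hc
      obtain rfl : b = c := Fin.ext (hb.trans hc.symm)
      omega

theorem zeroCount_cons {r : ℕ} (a : ℕ) (e : Fin r → ℕ) :
    zeroCount (Fin.cons a e : Fin (r + 1) → ℕ) = (if a = 0 then 1 else 0) + zeroCount e := by
  simp only [zeroCount, Finset.card_filter, Fin.sum_univ_succ, Fin.cons_zero, Fin.cons_succ]

theorem zeroCount_le {r : ℕ} (e : Fin r → ℕ) : zeroCount e ≤ r :=
  (Finset.card_filter_le _ _).trans (by simp)

theorem zeroCount_pos_iff {r : ℕ} (e : Fin r → ℕ) : 0 < zeroCount e ↔ ∃ i, e i = 0 := by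
  simp [zeroCount, Finset.card_pos, Finset.filter_nonempty_iff]

/-- The number of words in `shiftedAvoiders v p r K`. -/
noncomputable def numShiftedAvoiders (v p r : ℕ) (K : ℕ → Prop) : ℕ :=
  (shiftedAvoiders v p r K).ncard

/-! ### Deleting the first letter -/

theorem numShiftedAvoiders_empty (v p : ℕ) {K : ℕ → Prop} (hK : ¬ K 0) :
    numShiftedAvoiders v p 0 K = 0 := by
  have : shiftedAvoiders v p 0 K = ∅ := by
    ext e
    simp [shiftedAvoiders, zeroCount, hK]
  simp [numShiftedAvoiders, this]

/-- No letter is below a leading 0, so it starts no pattern and leaves the next letter its full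
range. -/
theorem numShiftedAvoiders_head_zero (p r : ℕ) (K : ℕ → Prop) :
    numShiftedAvoiders 0 p (r + 1) K =
      numShiftedAvoiders (p + 1) (p + 1) r (fun j => K (j + 1)) := by
  have : shiftedAvoiders 0 p (r + 1) K = (fun e : Fin r → ℕ => (Fin.cons 0 e : Fin (r + 1) → ℕ)) ''
      shiftedAvoiders (p + 1) (p + 1) r (fun j => K (j + 1)) := by
    ext e
    cases e using Fin.consCases with
    | cons a e =>
    simp only [shiftedAvoiders, Set.mem_ofPred_eq, Set.mem_image, contains120_cons, zeroCount_cons,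
      Fin.forall_fin_succ, Fin.cons_zero, Fin.cons_succ, Fin.val_zero, Fin.val_succ, Fin.cons_inj]
    constructor
    · rintro ⟨⟨-, h1⟩, h2, ⟨h3, -⟩, h4⟩
      obtain rfl : a = 0 := by simpa using h3
      refine ⟨e, ⟨fun i => by have := h1 i; omega, fun h => h2 (.inl h), ?_, ?_⟩, rfl, rfl⟩
      · intro i hi
        have := h1 i; omega
      · simpa [add_comm] using h4
    · rintro ⟨e', ⟨h1, h2, h3, h4⟩, rfl, rfl⟩
      refine ⟨⟨by omega, fun i => by have := h1 i; omega⟩, ?_, by simp, by simpa [add_comm] using h4⟩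
      simp [h2]
  rw [numShiftedAvoiders, this, Set.ncard_image_of_injective _ (Fin.cons_right_injective (α := fun _ => ℕ) 0),
    numShiftedAvoiders]

/-- The new words are those with head exactly `v + 1`. As `hK` forces a later zero, an ascent from
the head would complete a pattern. -/
theorem numShiftedAvoiders_head_succ {v p : ℕ} (hv : v + 1 ≤ p) (r : ℕ) {K : ℕ → Prop}
    (hK : ¬ K 0) :
    numShiftedAvoiders (v + 1) p (r + 1) K =
      numShiftedAvoiders v p (r + 1) K + numShiftedAvoiders (v + 1) (p + 1) r K := by
  have hU : shiftedAvoiders (v + 1) p (r + 1) K = shiftedAvoiders v p (r + 1) K ∪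
      (fun e : Fin r → ℕ => (Fin.cons (v + 1) e : Fin (r + 1) → ℕ)) ''
        shiftedAvoiders (v + 1) (p + 1) r K := by
    ext e
    cases e using Fin.consCases with
    | cons a e =>
    simp only [shiftedAvoiders, Set.mem_ofPred_eq, Set.mem_image, contains120_cons, zeroCount_cons,
      Fin.forall_fin_succ, Fin.cons_zero, Fin.cons_succ, Fin.val_zero, Fin.val_succ, Fin.cons_inj,
      Set.mem_union]
    constructor
    · rintro ⟨⟨h0, h1⟩, h2, ⟨h3, -⟩, h4⟩
      rcases Nat.lt_or_ge v a with ha | ha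
      · obtain rfl : a = v + 1 := by have := h3 trivial; omega
        simp only [Nat.add_eq_zero_iff, one_ne_zero, and_false, if_false, zero_add] at h4
        obtain ⟨c, hc⟩ := (zeroCount_pos_iff e).1
          (Nat.pos_of_ne_zero fun h => hK (h ▸ h4))
        refine .inr ⟨e, ⟨fun i => by have := h1 i; omega, fun h => h2 (.inl h), ?_, h4⟩, rfl, rfl⟩
        intro i hi
        by_contra! hlt
        exact h2 (.inr ⟨i, c, hi, by omega, hlt⟩)
      · exact .inl ⟨⟨h0, h1⟩, h2, ⟨fun _ => ha, by simp⟩, h4⟩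
    · rintro (⟨h1, h2, ⟨h3, -⟩, h4⟩ | ⟨e', ⟨h1, h2, h3, h4⟩, rfl, rfl⟩)
      · exact ⟨h1, h2, ⟨fun _ => (h3 trivial).trans (Nat.le_succ v), by simp⟩, h4⟩
      · refine ⟨⟨by omega, fun i => by have := h1 i; omega⟩, ?_, by simp, by simpa using h4⟩
        rintro (h | ⟨b, c, hb, -, hlt⟩)
        · exact h2 h
        · exact absurd (h3 b hb) (not_le.2 hlt)
  have hD : Disjoint (shiftedAvoiders v p (r + 1) K)
      ((fun e : Fin r → ℕ => (Fin.cons (v + 1) e : Fin (r + 1) → ℕ)) ''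
        shiftedAvoiders (v + 1) (p + 1) r K) := by
    rw [Set.disjoint_left]
    rintro _ h ⟨e, -, rfl⟩
    have := h.2.2.1 0 rfl
    simp at this
  rw [numShiftedAvoiders, hU, Set.ncard_union_eq hD (finite_shiftedAvoiders _ _ _ _)
    ((finite_shiftedAvoiders _ _ _ _).image _),
    Set.ncard_image_of_injective _ (Fin.cons_right_injective (α := fun _ => ℕ) _), numShiftedAvoiders,
    numShiftedAvoiders]

/-! ### The key identity -/

theorem contains120_succ_iff {r : ℕ} (e : Fin r → ℕ) :
    Contains120 (fun i => e i + 1) ↔ Contains120 e := by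
  simp [Contains120]

/-- Words without zeros are obtained from arbitrary ones by raising every entry. -/
theorem numShiftedAvoiders_no_zero (p r : ℕ) :
    numShiftedAvoiders (p + 1) (p + 1) r (fun j => j = 0) =
      numShiftedAvoiders p p r (fun j => 0 ≤ j) := by
  have : shiftedAvoiders (p + 1) (p + 1) r (fun j => j = 0) =
      (fun (e : Fin r → ℕ) i => e i + 1) '' shiftedAvoiders p p r (fun j => 0 ≤ j) := by
    ext e
    constructor
    · rintro ⟨h1, h2, h3, h4⟩
      have hpos : ∀ i, e i ≠ 0 := by
        intro i hi
        have := (zeroCount_pos_iff e).2 ⟨i, hi⟩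
        omega
      have he : (fun i => (e i - 1) + 1) = e := by
        funext i
        have := hpos i; omega
      refine ⟨fun i => e i - 1, ⟨fun i => ?_, ?_, fun i hi => ?_, Nat.zero_le _⟩, he⟩
      · have := h1 i; dsimp only; omega
      · rwa [← contains120_succ_iff, he]
      · have := h3 i hi; dsimp only; omega
    · rintro ⟨e, ⟨h1, h2, h3, -⟩, rfl⟩
      refine ⟨fun i => ?_, by rwa [contains120_succ_iff], fun i hi => ?_, by simp [zeroCount]⟩
      · have := h1 i; dsimp only; omega
      · have := h3 i hi; dsimp only; omega
  rw [numShiftedAvoiders, this, Set.ncard_image_of_injective, numShiftedAvoiders]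
  intro e f h
  funext i
  simpa using congrFun h i

/-- The recurrence for `numShiftedAvoiders_eq`, passed from words at full head bound with `k` zeros
to words with `k + 1` zeros at any smaller head bound. -/
theorem numShiftedAvoiders_succ_eq_of {k : ℕ}
    (ih : ∀ p r, numShiftedAvoiders (p + 1) (p + 1) r (fun j => j = k) =
      numShiftedAvoiders p p r (fun j => k ≤ j) +
        k * numShiftedAvoiders (p + 1) (p + 1) (r - 1) (fun j => k ≤ j)) (r : ℕ) :
    ∀ p v, v ≤ p → numShiftedAvoiders (v + 1) (p + 1) r (fun j => j = k + 1) =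
      numShiftedAvoiders v p r (fun j => k + 1 ≤ j) +
        (k + 1) * numShiftedAvoiders (v + 1) (p + 1) (r - 1) (fun j => k + 1 ≤ j) := by
  have hE : ¬ (0 = k + 1) := by omega
  have hG : ¬ (k + 1 ≤ 0) := by omega
  have hE0 := fun v p => numShiftedAvoiders_empty v p (K := fun j => j = k + 1) hE
  have hG0 := fun v p => numShiftedAvoiders_empty v p (K := fun j => k + 1 ≤ j) hG
  have hEz := fun p r => numShiftedAvoiders_head_zero p r (fun j => j = k + 1)
  have hGz := fun p r => numShiftedAvoiders_head_zero p r (fun j => k + 1 ≤ j)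
  simp only [Nat.add_right_cancel_iff, Nat.add_le_add_iff_right] at hEz hGz
  induction r with
  | zero => intro p v _; rw [hE0, hG0, hG0]; rfl
  | succ r ihr =>
    have hzero : ∀ p, numShiftedAvoiders 0 (p + 1) (r + 1) (fun j => j = k + 1) =
        numShiftedAvoiders 0 p (r + 1) (fun j => k + 1 ≤ j) +
          k * numShiftedAvoiders 0 (p + 1) r (fun j => k + 1 ≤ j) := by
      intro p
      rw [hEz, hGz, ih]
      -- At `r = 0` the truncated `r - 1` is harmless: the factor `k` is 0, or the empty word has
      -- too few zeros.
      rcases r with _ | r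
      · rw [hG0]
        rcases k with _ | k
        · simp
        · rw [numShiftedAvoiders_empty _ _ (by omega)]
          simp [numShiftedAvoiders_empty]
      · rw [hGz]; rfl
    have hstep : ∀ p v, v ≤ p →
        numShiftedAvoiders (v + 1) (p + 1) r (fun j => k + 1 ≤ j) =
          numShiftedAvoiders v (p + 1) r (fun j => k + 1 ≤ j) +
            numShiftedAvoiders (v + 1) (p + 2) (r - 1) (fun j => k + 1 ≤ j) := by
      intro p v hv
      rcases r with _ | r
      · rw [hG0, hG0, hG0]
      · exact numShiftedAvoiders_head_succ (by omega) r hG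
    intro p v
    induction v with
    | zero =>
      intro hv
      -- The first term of `ihr` is the extra copy that raises the coefficient `k` of `hzero` to `k
      -- + 1`.
      rw [numShiftedAvoiders_head_succ (by omega) r hE, hzero, ihr (p + 1) 0 (by omega),
        Nat.add_sub_cancel, hstep p 0 (by omega)]
      ring
    | succ v ihv =>
      intro hv
      rw [numShiftedAvoiders_head_succ (by omega) r hE, ihv (by omega),
        ihr (p + 1) (v + 1) (by omega), Nat.add_sub_cancel, hstep p (v + 1) (by omega),
        numShiftedAvoiders_head_succ (by omega) r hG]
      ring

theorem numShiftedAvoiders_eq (k : ℕ) : ∀ p r,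
    numShiftedAvoiders (p + 1) (p + 1) r (fun j => j = k) =
      numShiftedAvoiders p p r (fun j => k ≤ j) +
        k * numShiftedAvoiders (p + 1) (p + 1) (r - 1) (fun j => k ≤ j) := by
  induction k with
  | zero => intro p r; simp [numShiftedAvoiders_no_zero]
  | succ k ih => exact fun p r => numShiftedAvoiders_succ_eq_of ih r p p le_rfl

theorem numShiftedAvoiders_ge_eq_add (v p r k : ℕ) :
    numShiftedAvoiders v p r (fun j => k ≤ j) =
      numShiftedAvoiders v p r (fun j => j = k) +
        numShiftedAvoiders v p r (fun j => k + 1 ≤ j) := by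
  rw [numShiftedAvoiders, numShiftedAvoiders, numShiftedAvoiders, ← Set.ncard_union_eq _
    (finite_shiftedAvoiders _ _ _ _) (finite_shiftedAvoiders _ _ _ _)]
  · congr 1
    ext e
    simp only [shiftedAvoiders, Set.mem_ofPred_eq, Set.mem_union, ← and_or_left]
    have : k ≤ zeroCount e ↔ zeroCount e = k ∨ k + 1 ≤ zeroCount e := by omega
    rw [this]
  · rw [Set.disjoint_left]
    rintro e ⟨-, -, -, h⟩ ⟨-, -, -, h'⟩
    omega

theorem numShiftedAvoiders_ge_eq_sum (v p r k : ℕ) :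
    numShiftedAvoiders v p r (fun j => k ≤ j) =
      ∑ i ∈ Finset.Icc k r, numShiftedAvoiders v p r (fun j => j = i) := by
  induction hd : r + 1 - k generalizing k with
  | zero =>
    have : shiftedAvoiders v p r (fun j => k ≤ j) = ∅ := by
      ext e
      have := zeroCount_le e
      simp only [shiftedAvoiders, Set.mem_ofPred_eq, Set.mem_empty_iff_false, iff_false]
      omega
    simp [numShiftedAvoiders, this, show r < k by omega]
  | succ d ih =>
    rw [numShiftedAvoiders_ge_eq_add, ih (k + 1) (by omega),
      ← Finset.insert_Icc_add_one_left_eq_Icc (show k ≤ r by omega), Finset.sum_insert (by simp)]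

/-! ### The recurrence for c_{n,k} -/

theorem avoidingInvSeq_eq (n k : ℕ) :
    avoidingInvSeq n k = shiftedAvoiders 0 0 n (fun j => j = k) := by
  ext e
  simp only [avoidingInvSeq, shiftedAvoiders, IsInversionSeq, Set.mem_ofPred_eq, Nat.lt_succ_iff,
    zero_add]
  constructor
  · rintro ⟨h1, h2, h3⟩
    exact ⟨h1, h2, fun i hi => hi ▸ h1 i, h3⟩
  · rintro ⟨h1, h2, -, h3⟩
    exact ⟨h1, h2, h3⟩

theorem numShiftedAvoiders_zero_eq_refinedPoweredCatalan (n : ℕ) :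
    ∀ k, numShiftedAvoiders 0 0 (n + 1) (fun j => j = k) = refinedPoweredCatalan (n + 1) k := by
  have hpos : ∀ n, numShiftedAvoiders 0 0 (n + 1) (fun j => j = 0) = 0 := by
    intro n
    rw [numShiftedAvoiders_head_zero]
    simp [numShiftedAvoiders, shiftedAvoiders]
  induction n with
  | zero =>
    intro k
    rcases k with _ | k
    · rw [hpos, refinedPoweredCatalan_zero_right]
    · rw [numShiftedAvoiders_head_zero]
      rcases k with _ | k
      · have : shiftedAvoiders 1 1 0 (fun j => j + 1 = 0 + 1) = Set.univ := by
          ext e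
          simp [shiftedAvoiders, zeroCount, Contains120]
        rw [numShiftedAvoiders, this]
        simp [Set.ncard_univ, refinedPoweredCatalan]
      · rw [numShiftedAvoiders_empty _ _ (by omega)]
        simp [refinedPoweredCatalan]
  | succ n ih =>
    intro k
    rcases k with _ | k
    · rw [hpos, refinedPoweredCatalan_zero_right]
    · rw [refinedPoweredCatalan_rec _ _ (by omega) (by omega), numShiftedAvoiders_head_zero]
      simp only [Nat.add_right_cancel_iff, zero_add, Nat.add_sub_cancel, ← ih]
      -- Splitting "at least k zeros" gives c_{n+1,k} and one tail sum; the key identity supplies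
      -- the other `k` copies.
      rw [← numShiftedAvoiders_ge_eq_sum, numShiftedAvoiders_eq k 0,
        numShiftedAvoiders_ge_eq_add, Nat.add_sub_cancel, numShiftedAvoiders_head_zero 0 n
          (fun j => k + 1 ≤ j)]
      simp only [Nat.add_le_add_iff_right, zero_add]
      ring

theorem mainTheorem2 (n k : ℕ) (hn : 1 ≤ n) (hk : 1 ≤ k) (hkn : k ≤ n) :
    (avoidingInvSeq n k).ncard = refinedPoweredCatalan n k := by
  obtain ⟨n, rfl⟩ := Nat.exists_eq_add_of_le' hn
  rw [avoidingInvSeq_eq]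
  exact numShiftedAvoiders_zero_eq_refinedPoweredCatalan n k
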